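/- Let $\alpha\in(0,1]$ and let $F_\alpha:[0,\infty)\to\mathbb R$ be the solution of the initial value problem $$F_\alpha'(x)=1-F_\alpha(x)^\alpha\quad(x\ge 0),\qquad F_\alpha(0)=0$$ (at $x=0$ the derivative is the right derivative; this solution exists and is unique). Then there is a positive measure $\sigma_\alpha$ on $[0,\infty)$ with $\sigma_\alpha([0,\infty))=1-F_\alpha(0)=1$, that is, a probability measure, such that $$1-F_\alpha(x)=\int_0^{\infty}e^{-xt}\,d\sigma_\alpha(t)\qquad\text{for all }x\ge 0.$$ -/

import Mathlib

open MeasureTheory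
open scoped NNReal

/-- `F` solves, on the half-line `[0, ∞)`, the initial value problem
`F'(x) = 1 - F(x) ^ α`, `F(0) = 0` (at `x = 0` the derivative is the right derivative).
Only the values of `F` on `[0, ∞)` matter. -/
structure IsProfileFunction (α : ℝ) (F : ℝ → ℝ) : Prop where
  map_zero : F 0 = 0
  hasDeriv : ∀ x : ℝ, 0 ≤ x → HasDerivWithinAt F (1 - F x ^ α) (Set.Ici 0) x

open Filter Topology ENNReal

/-! Put `G = 1 - F`, so that `G' = -(1 - (1 - G)^α)` and `G(0) = 1`. For `0 ≤ s < 1`, `1 - (1 - s)^α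
= α s + ∑ dₖ sᵏ` with `k ≥ 2` and `dₖ ≥ 0`. Linearising at the equilibrium `G = 0` suggests `G(x) =
f(r e^{-αx})`, where `f = X + ⋯` solves `α(X f' - f) = ∑ dₖ fᵏ`. Comparing coefficients determines
`f` recursively, with all coefficients nonnegative. If `f(r) = 1`, then `G(x) = ∑ fₙ rⁿ e^{-αnx}` is
the Laplace transform of the atomic probability measure with mass `fₙ rⁿ` at `αn`.

The main point is the existence of `r` (`exists_ennSum_koenigs_eq_one`): while `f < 1`, the equation
lets `f` be continued past its current argument with value at most `1`. Coefficients live in `[0,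
∞]`, so sums and suprema commute and convergence is only checked at the end. Uniqueness for the
initial value problem (`IsProfileFunction.eqOn`) transfers the formula to every solution. -/

/-! ### Binomial coefficients and the expansion of `1 - (1 - s)^α` -/

theorem Ring.succ_mul_choose_succ (α : ℝ) (k : ℕ) :
    ((k : ℝ) + 1) * Ring.choose α (k + 1) = (α - k) * Ring.choose α k := by
  have h1 := Ring.descPochhammer_eq_factorial_smul_choose α (k + 1)
  have h0 := Ring.descPochhammer_eq_factorial_smul_choose α k
  rw [descPochhammer_succ_right, Polynomial.smeval_mul, h0, Polynomial.smeval_sub,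
    Polynomial.smeval_X, Polynomial.smeval_natCast, Nat.factorial_succ] at h1
  simp only [nsmul_eq_mul, pow_one, pow_zero, mul_one, Nat.cast_mul, Nat.cast_add,
    Nat.cast_one] at h1
  have hk : (k.factorial : ℝ) ≠ 0 := by positivity
  apply mul_left_cancel₀ hk
  linarith

/-- The coefficients of order at least two of the power series of `1 - (1 - s) ^ α`. -/
noncomputable def rpowTail (α : ℝ) (k : ℕ) : ℝ :=
  if k < 2 then 0 else -((-1) ^ k * Ring.choose α k)

/-- Consecutive terms have ratio `(k + 1 - α) / (k + 2) ≥ 0`, and the first one is `-α`. -/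
theorem neg_one_pow_mul_choose_nonpos {α : ℝ} (h0 : 0 < α) (h1 : α ≤ 1) (k : ℕ) :
    (-1) ^ (k + 1) * Ring.choose α (k + 1) ≤ 0 := by
  induction k with
  | zero => simp [h0.le]
  | succ k ih =>
    have h := Ring.succ_mul_choose_succ α (k + 1)
    push_cast at h
    have hk : (0 : ℝ) < (k : ℝ) + 1 + 1 := by positivity
    have e : ((k : ℝ) + 1 + 1) * ((-1) ^ (k + 1 + 1) * Ring.choose α (k + 1 + 1))
        = ((k : ℝ) + 1 - α) * ((-1) ^ (k + 1) * Ring.choose α (k + 1)) := by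
      rw [pow_succ (-1 : ℝ) (k + 1)]
      linear_combination (-(-1 : ℝ) ^ (k + 1)) * h
    have h3 : ((k : ℝ) + 1 + 1) * ((-1) ^ (k + 1 + 1) * Ring.choose α (k + 1 + 1)) ≤ 0 := by
      rw [e]
      exact mul_nonpos_of_nonneg_of_nonpos (by have := k.cast_nonneg (α := ℝ); linarith) ih
    exact nonpos_of_mul_nonpos_right h3 hk

theorem rpowTail_nonneg {α : ℝ} (h0 : 0 < α) (h1 : α ≤ 1) (k : ℕ) : 0 ≤ rpowTail α k := by
  unfold rpowTail
  split_ifs with h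
  · exact le_rfl
  · obtain ⟨m, rfl⟩ := Nat.exists_eq_add_of_le' (show 1 ≤ k by omega)
    linarith [neg_one_pow_mul_choose_nonpos h0 h1 m]

theorem hasSum_rpowTail {α : ℝ} {s : ℝ} (hs0 : 0 ≤ s) (hs1 : s < 1) :
    HasSum (fun k => rpowTail α k * s ^ k) (1 - (1 - s) ^ α - α * s) := by
  have h := (Real.one_add_rpow_hasFPowerSeriesOnBall_zero (a := α)).hasSum (y := -s) (by
    simp [enorm]
    rw [← NNReal.coe_lt_coe]
    simpa [abs_of_nonneg hs0] using hs1)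
  have h2 : HasSum (fun k => (if k = 0 then (1 : ℝ) else 0) - (if k = 1 then α * s else 0)
      - Ring.choose α k * (-s) ^ k) (1 - α * s - (1 - s) ^ α) := by
    refine ((hasSum_ite_eq 0 1).sub (hasSum_ite_eq 1 (α * s))).sub ?_
    convert! h using 2
    · rw [binomialSeries_apply]
      simp
    · ring
  convert! h2 using 1
  · ext k
    unfold rpowTail
    match k with
    | 0 => simp
    | 1 => simp
    | k + 2 =>
      simp
      rw [neg_pow s]
      ring
  · ring

/-- Finite partial sums at `s < 1` are at most `1 - (1 - s)^α - αs ≤ 1`; let `s` increase to `1`. -/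
theorem tsum_ofReal_rpowTail_le {α : ℝ} (h0 : 0 < α) (h1 : α ≤ 1) :
    ∑' k, ENNReal.ofReal (rpowTail α k) ≤ 1 := by
  rw [ENNReal.tsum_eq_iSup_sum]
  refine iSup_le fun t => ?_
  rw [← ENNReal.ofReal_sum_of_nonneg fun k _ => rpowTail_nonneg h0 h1 k]
  refine ENNReal.ofReal_le_one.2 ?_
  have hc : Tendsto (fun s : ℝ => ∑ k ∈ t, rpowTail α k * s ^ k) (𝓝[<] 1)
      (𝓝 (∑ k ∈ t, rpowTail α k * (1 : ℝ) ^ k)) :=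
    (Continuous.tendsto (by fun_prop) _).mono_left nhdsWithin_le_nhds
  simp only [one_pow, mul_one] at hc
  refine le_of_tendsto hc ?_
  filter_upwards [Ioo_mem_nhdsLT (show (0 : ℝ) < 1 by norm_num)] with s hs
  have h := sum_le_hasSum t
    (fun k _ => mul_nonneg (rpowTail_nonneg h0 h1 k) (pow_nonneg hs.1.le k))
    (hasSum_rpowTail (α := α) hs.1.le hs.2)
  have h2 : 0 ≤ (1 - s) ^ α := Real.rpow_nonneg (by linarith [hs.2]) _
  have h3 : 0 ≤ α * s := mul_nonneg h0.le hs.1.le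
  linarith

/-! ### Monotone suprema and power series with coefficients in `[0, ∞]` -/

theorem ENNReal.tsum_iSup_of_monotone {ι : Type*} {f : ι → ℕ → ℝ≥0∞} (hf : ∀ i, Monotone (f i)) :
    ∑' i, ⨆ m, f i m = ⨆ m, ∑' i, f i m := by
  simp_rw [ENNReal.tsum_eq_iSup_sum, ENNReal.finsetSum_iSup_of_monotone hf]
  exact iSup_comm

theorem ENNReal.iSup_mul_iSup_of_monotone {f g : ℕ → ℝ≥0∞} (hf : Monotone f) (hg : Monotone g) :
    (⨆ m, f m) * ⨆ m, g m = ⨆ m, f m * g m := by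
  refine le_antisymm ?_ (iSup_le fun m => mul_le_mul' (le_iSup f m) (le_iSup g m))
  rw [ENNReal.iSup_mul]
  refine iSup_le fun i => ?_
  rw [ENNReal.mul_iSup]
  refine iSup_le fun j => le_iSup_of_le (max i j) ?_
  exact mul_le_mul' (hf (le_max_left _ _)) (hg (le_max_right _ _))

namespace PowerSeries

/-- The value at `z` of a power series with coefficients in `[0, ∞]`. -/
noncomputable def ennSum (f : PowerSeries ℝ≥0∞) (z : ℝ≥0∞) : ℝ≥0∞ := ∑' n, coeff n f * z ^ n

/-- The value at `z` of `(f - f(0)) / X`. -/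
noncomputable def ennSlope (f : PowerSeries ℝ≥0∞) (z : ℝ≥0∞) : ℝ≥0∞ :=
  ∑' n, coeff (n + 1) f * z ^ n

theorem ennSum_eq_mul_ennSlope {f : PowerSeries ℝ≥0∞} (hf : coeff 0 f = 0) (z : ℝ≥0∞) :
    ennSum f z = z * ennSlope f z := by
  rw [ennSum, ennSlope, tsum_eq_zero_add' ENNReal.summable, hf, zero_mul, zero_add,
    ← ENNReal.tsum_mul_left]
  exact tsum_congr fun n => by rw [pow_succ]; ring

theorem ennSum_one (z : ℝ≥0∞) : ennSum 1 z = 1 := by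
  rw [ennSum, tsum_eq_single 0]
  · simp
  · intro n hn
    simp [coeff_one, hn]

theorem ennSum_mul (f g : PowerSeries ℝ≥0∞) (z : ℝ≥0∞) :
    ennSum (f * g) z = ennSum f z * ennSum g z := by
  simp_rw [ennSum, ← ENNReal.tsum_mul_right, ← ENNReal.tsum_mul_left]
  rw [← ENNReal.tsum_prod (f := fun i j => coeff i f * z ^ i * (coeff j g * z ^ j)),
    ← Finset.HasAntidiagonal.sigmaAntidiagonalEquivProd.tsum_eq, ENNReal.tsum_sigma']
  refine tsum_congr fun n => ?_
  rw [coeff_mul, tsum_fintype, Finset.univ_eq_attach,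
    Finset.sum_mul, ← Finset.sum_attach]
  refine Finset.sum_congr rfl fun p _ => ?_
  have hp := Finset.HasAntidiagonal.mem_antidiagonal.1 p.2
  simp only [Finset.HasAntidiagonal.sigmaAntidiagonalEquivProd_apply]
  rw [show z ^ n = z ^ p.1.1 * z ^ p.1.2 by rw [← pow_add, hp]]
  ring

theorem ennSum_pow (f : PowerSeries ℝ≥0∞) (z : ℝ≥0∞) (k : ℕ) :
    ennSum (f ^ k) z = ennSum f z ^ k := by
  induction k with
  | zero => simp [ennSum_one]
  | succ k ih => rw [pow_succ, pow_succ, ennSum_mul, ih]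

/-- The composition `∑ₖ dₖ fᵏ` of power series with coefficients in `[0, ∞]`. -/
noncomputable def ennComp (d : ℕ → ℝ≥0∞) (f : PowerSeries ℝ≥0∞) : PowerSeries ℝ≥0∞ :=
  mk fun n => ∑' k, d k * coeff n (f ^ k)

theorem ennSum_ennComp (d : ℕ → ℝ≥0∞) (f : PowerSeries ℝ≥0∞) (z : ℝ≥0∞) :
    ennSum (ennComp d f) z = ∑' k, d k * ennSum f z ^ k := by
  simp_rw [← ennSum_pow, ennSum, ennComp, coeff_mk, ← ENNReal.tsum_mul_right,
    ← ENNReal.tsum_mul_left]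
  rw [ENNReal.tsum_comm]
  exact tsum_congr fun k => tsum_congr fun n => by ring

theorem coeff_pow_mono {f g : PowerSeries ℝ≥0∞} (h : ∀ n, coeff n f ≤ coeff n g) (k n : ℕ) :
    coeff n (f ^ k) ≤ coeff n (g ^ k) := by
  induction k generalizing n with
  | zero => simp
  | succ k ih =>
    simp_rw [pow_succ, coeff_mul]
    exact Finset.sum_le_sum fun p _ => mul_le_mul' (ih _) (h _)

theorem coeff_ennComp_mono (d : ℕ → ℝ≥0∞) {f g : PowerSeries ℝ≥0∞}
    (h : ∀ n, coeff n f ≤ coeff n g) (n : ℕ) :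
    coeff n (ennComp d f) ≤ coeff n (ennComp d g) := by
  simp only [ennComp, coeff_mk]
  exact ENNReal.tsum_le_tsum fun k => mul_le_mul' le_rfl (coeff_pow_mono h k n)

theorem coeff_pow_iSup {y : ℕ → PowerSeries ℝ≥0∞} (hy : ∀ n, Monotone fun m => coeff n (y m))
    (k n : ℕ) :
    coeff n ((mk fun n => ⨆ m, coeff n (y m)) ^ k) = ⨆ m, coeff n (y m ^ k) := by
  induction k generalizing n with
  | zero => simp
  | succ k ih =>
    have hm : ∀ n, Monotone fun m => coeff n (y m ^ k) := fun n i j hij =>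
      coeff_pow_mono (fun n => hy n hij) k n
    simp_rw [pow_succ, coeff_mul, ih, coeff_mk]
    rw [← ENNReal.finsetSum_iSup_of_monotone]
    · exact Finset.sum_congr rfl fun p _ => ENNReal.iSup_mul_iSup_of_monotone (hm _) (hy _)
    · exact fun p i j hij => mul_le_mul' (hm _ hij) (hy _ hij)

theorem coeff_ennComp_iSup (d : ℕ → ℝ≥0∞) {y : ℕ → PowerSeries ℝ≥0∞}
    (hy : ∀ n, Monotone fun m => coeff n (y m)) (n : ℕ) :
    coeff n (ennComp d (mk fun n => ⨆ m, coeff n (y m))) = ⨆ m, coeff n (ennComp d (y m)) := by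
  simp only [ennComp, coeff_mk, coeff_pow_iSup hy, ENNReal.mul_iSup]
  exact ENNReal.tsum_iSup_of_monotone fun k i j hij =>
    mul_le_mul' le_rfl (coeff_pow_mono (fun n => hy n hij) k n)

/-- The operator whose fixed points are the solutions `f = X + ⋯` of
`α (X f' - f) = ∑ₖ dₖ fᵏ`. -/
noncomputable def koenigsStep (d : ℕ → ℝ≥0∞) (α : ℝ≥0) (f : PowerSeries ℝ≥0∞) :
    PowerSeries ℝ≥0∞ :=
  mk fun n => Nat.casesOn n 0 fun n =>
    (if n = 0 then 1 else 0) + ((α * n)⁻¹ : ℝ≥0) * coeff (n + 1) (ennComp d f)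

/-! ### The least fixed point of `koenigsStep`: growth and differential equation -/

section

variable (d : ℕ → ℝ≥0∞) (α : ℝ≥0)

@[simp] theorem coeff_zero_koenigsStep (f : PowerSeries ℝ≥0∞) :
    coeff 0 (koenigsStep d α f) = 0 := by
  rw [koenigsStep, coeff_mk]
  rfl

theorem coeff_succ_koenigsStep (f : PowerSeries ℝ≥0∞) (n : ℕ) :
    coeff (n + 1) (koenigsStep d α f)
      = (if n = 0 then 1 else 0) + ((α * n)⁻¹ : ℝ≥0) * coeff (n + 1) (ennComp d f) := by
  simp only [koenigsStep, coeff_mk]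

/-- The iterates of `koenigsStep` from `0`. -/
noncomputable def koenigsIter (m : ℕ) : PowerSeries ℝ≥0∞ := (koenigsStep d α)^[m] 0

theorem koenigsIter_succ (m : ℕ) :
    koenigsIter d α (m + 1) = koenigsStep d α (koenigsIter d α m) :=
  Function.iterate_succ_apply' _ _ _

theorem koenigsIter_zero : koenigsIter d α 0 = 0 := rfl

theorem coeff_zero_koenigsIter (m : ℕ) : coeff 0 (koenigsIter d α m) = 0 := by
  cases m with
  | zero => simp [koenigsIter_zero]
  | succ m => rw [koenigsIter_succ, coeff_zero_koenigsStep]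

theorem coeff_koenigsStep_mono {f g : PowerSeries ℝ≥0∞} (h : ∀ n, coeff n f ≤ coeff n g)
    (n : ℕ) : coeff n (koenigsStep d α f) ≤ coeff n (koenigsStep d α g) := by
  cases n with
  | zero => simp
  | succ n =>
    simp only [coeff_succ_koenigsStep]
    gcongr
    exact coeff_ennComp_mono d h _

theorem coeff_koenigsIter_mono (n : ℕ) : Monotone fun m => coeff n (koenigsIter d α m) := by
  refine monotone_nat_of_le_succ fun m => ?_
  induction m generalizing n with
  | zero => simp [koenigsIter_zero]
  | succ m ih =>
    rw [koenigsIter_succ d α (m + 1), koenigsIter_succ d α m]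
    refine coeff_koenigsStep_mono d α (fun n => ?_) n
    rw [← koenigsIter_succ]
    exact ih n

/-- The least fixed point of `koenigsStep`. -/
noncomputable def koenigs : PowerSeries ℝ≥0∞ := mk fun n => ⨆ m, coeff n (koenigsIter d α m)

theorem coeff_koenigsIter_le (m n : ℕ) : coeff n (koenigsIter d α m) ≤ coeff n (koenigs d α) := by
  rw [koenigs, coeff_mk]
  exact le_iSup (fun m => coeff n (koenigsIter d α m)) m

theorem koenigsStep_koenigs : koenigsStep d α (koenigs d α) = koenigs d α := by
  ext n
  have hs : coeff n (koenigs d α) = ⨆ m, coeff n (koenigsIter d α (m + 1)) := by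
    rw [koenigs, coeff_mk]
    exact ((coeff_koenigsIter_mono d α n).iSup_nat_add 1).symm
  rw [hs]
  simp only [koenigsIter_succ]
  cases n with
  | zero => simp
  | succ n =>
    simp only [coeff_succ_koenigsStep]
    rw [koenigs, coeff_ennComp_iSup d (coeff_koenigsIter_mono d α), ENNReal.mul_iSup,
      ENNReal.add_iSup]

theorem coeff_zero_koenigs : coeff 0 (koenigs d α) = 0 := by
  rw [← koenigsStep_koenigs, coeff_zero_koenigsStep]

theorem coeff_one_koenigs : coeff 1 (koenigs d α) = 1 := by
  rw [← koenigsStep_koenigs, coeff_succ_koenigsStep]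
  simp

theorem ennSum_koenigs_le {z B : ℝ≥0∞} (h : ∀ m, ennSum (koenigsIter d α m) z ≤ B) :
    ennSum (koenigs d α) z ≤ B := by
  simp only [ennSum, koenigs, coeff_mk, ENNReal.iSup_mul]
  rw [ENNReal.tsum_iSup_of_monotone]
  · exact iSup_le h
  · exact fun n i j hij => mul_le_mul' (coeff_koenigsIter_mono d α n hij) le_rfl

variable {d α}

theorem ennSum_ennComp_le (h0 : d 0 = 0) (h1 : d 1 = 0) (hd : ∑' k, d k ≤ 1)
    {f : PowerSeries ℝ≥0∞} {z : ℝ≥0∞} (hf : ennSum f z ≤ 1) :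
    ennSum (ennComp d f) z ≤ ennSum f z ^ 2 := by
  rw [ennSum_ennComp]
  calc ∑' k, d k * ennSum f z ^ k ≤ ∑' k, d k * ennSum f z ^ 2 := by
        refine ENNReal.tsum_le_tsum fun k => ?_
        match k with
        | 0 => simp [h0]
        | 1 => simp [h1]
        | k + 2 => exact mul_le_mul' le_rfl (pow_le_pow_right_of_le_one' hf (by omega))
    _ ≤ ennSum f z ^ 2 := by
        rw [ENNReal.tsum_mul_right]
        exact mul_le_of_le_one_left' hd

/-- With `z = w + δ`, the bound `zⁿ - wⁿ ≤ n δ zⁿ⁻¹` cancels the `n` in `(αn)⁻¹`. One step is thus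
controlled beyond `w` by the undivided composition. -/
theorem ennSlope_koenigsStep_le (hα : α ≠ 0) (f : PowerSeries ℝ≥0∞) (w δ : ℝ≥0)
    (hz : w + δ ≠ 0) :
    ennSlope (koenigsStep d α f) ↑(w + δ) ≤ ennSlope (koenigsStep d α f) w
      + ((δ / (α * (w + δ) ^ 2) : ℝ≥0) : ℝ≥0∞) * ennSum (ennComp d f) ↑(w + δ) := by
  set z := w + δ with hzd
  have key : ∀ n : ℕ, (α * n)⁻¹ * z ^ n ≤ (α * n)⁻¹ * w ^ n + δ / (α * z ^ 2) * z ^ (n + 1) := by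
    intro n
    match n with
    -- Here `(α * 0)⁻¹ = 0`.
    | 0 => simp
    | n + 1 =>
      have h : z ^ (n + 1) ≤ w ^ (n + 1) + (n + 1 : ℕ) * δ * z ^ n := by
        induction n with
        | zero => simp [hzd]
        | succ n ih =>
          calc z ^ (n + 1 + 1) = z ^ (n + 1) * w + δ * z ^ (n + 1) := by
                rw [pow_succ z (n + 1)]; nth_rewrite 2 [hzd]; ring
            _ ≤ (w ^ (n + 1) + (n + 1 : ℕ) * δ * z ^ n) * w + δ * z ^ (n + 1) := by gcongr
            _ ≤ w ^ (n + 1 + 1) + (n + 1 : ℕ) * δ * (z ^ n * z) + δ * z ^ (n + 1) := by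
                have : w ≤ z := by rw [hzd]; exact le_self_add
                calc _ = w ^ (n + 1 + 1) + (n + 1 : ℕ) * δ * (z ^ n * w) + δ * z ^ (n + 1) := by
                      ring
                  _ ≤ _ := by gcongr
            _ = _ := by push_cast; ring
      calc _ ≤ (α * (n + 1 : ℕ))⁻¹ * (w ^ (n + 1) + (n + 1 : ℕ) * δ * z ^ n) := by gcongr
        _ = _ := by
          have hn : ((n + 1 : ℕ) : ℝ≥0) ≠ 0 := by positivity
          field_simp
          ring
  simp only [ennSlope, ennSum, coeff_succ_koenigsStep, add_mul]
  rw [tsum_eq_zero_add' (f := fun n => coeff n (ennComp d f) * (z : ℝ≥0∞) ^ n) ENNReal.summable,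
    ENNReal.tsum_add, ENNReal.tsum_add, add_assoc]
  have e : ∀ x : ℝ≥0∞, ∑' n : ℕ, (if n = 0 then 1 else 0) * x ^ n = 1 := by
    intro x
    rw [tsum_eq_single 0]
    · simp
    · intro n hn; simp [hn]
  rw [e, e]
  gcongr
  refine le_trans ?_ (add_le_add le_rfl (mul_le_mul' le_rfl le_add_self))
  rw [← ENNReal.tsum_mul_left, ← ENNReal.tsum_add]
  refine ENNReal.tsum_le_tsum fun n => ?_
  have h : (((α * n)⁻¹ : ℝ≥0) : ℝ≥0∞) * (z : ℝ≥0∞) ^ n ≤ (((α * n)⁻¹ : ℝ≥0) : ℝ≥0∞) * (w : ℝ≥0∞) ^ n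
      + ((δ / (α * z ^ 2) : ℝ≥0) : ℝ≥0∞) * (z : ℝ≥0∞) ^ (n + 1) := by
    exact_mod_cast key n
  calc _ = coeff (n + 1) (ennComp d f) * ((((α * n)⁻¹ : ℝ≥0) : ℝ≥0∞) * (z : ℝ≥0∞) ^ n) := by ring
    _ ≤ _ := mul_le_mul' le_rfl h
    _ = _ := by ring

theorem ennSlope_koenigsStep_zero (f : PowerSeries ℝ≥0∞) :
    ennSlope (koenigsStep d α f) 0 = 1 := by
  rw [ennSlope, tsum_eq_single 0]
  · simp [coeff_succ_koenigsStep]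
  · intro _ hn
    simp [hn]

/-- The bound `2` on the slope reproduces itself at `α/4`: it gives `f ≤ α/2`, so the composition is
at most `α²/4`, and the new slope is at most `1 + (4/α²)(α²/4) = 2`. -/
theorem ennSum_koenigsIter_small (hα : α ≠ 0) (hα1 : α ≤ 1)
    (h0 : d 0 = 0) (h1 : d 1 = 0) (hd : ∑' k, d k ≤ 1) (m : ℕ) :
    ennSum (koenigsIter d α m) ↑(α / 4) ≤ 1 := by
  have h4 : α / 4 ≠ 0 := by positivity
  have hb : ∀ f : PowerSeries ℝ≥0∞, coeff 0 f = 0 → ennSlope f ↑(α / 4) ≤ 2 →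
      ennSum f ↑(α / 4) ≤ ((α / 2 : ℝ≥0) : ℝ≥0∞) := by
    intro f hf hs
    rw [ennSum_eq_mul_ennSlope hf]
    calc _ ≤ ((α / 4 : ℝ≥0) : ℝ≥0∞) * 2 := mul_le_mul' le_rfl hs
      _ = ((α / 4 * 2 : ℝ≥0) : ℝ≥0∞) := by push_cast; rfl
      _ = _ := by congr 1; field_simp; norm_num
  have hle : ((α / 2 : ℝ≥0) : ℝ≥0∞) ≤ 1 := by
    rw [← ENNReal.coe_one, ENNReal.coe_le_coe]
    exact (NNReal.half_le_self α).trans hα1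
  suffices h : ennSlope (koenigsIter d α m) ↑(α / 4) ≤ 2 from
    (hb _ (coeff_zero_koenigsIter d α m) h).trans hle
  induction m with
  | zero => simp [koenigsIter_zero, ennSlope]
  | succ m ih =>
    have hm := hb _ (coeff_zero_koenigsIter d α m) ih
    have h := ennSlope_koenigsStep_le (d := d) hα (koenigsIter d α m) 0 (α / 4) (by simpa using h4)
    rw [ENNReal.coe_zero, ennSlope_koenigsStep_zero, zero_add] at h
    rw [koenigsIter_succ]
    refine h.trans ?_
    calc _ ≤ 1 + ((α / 4 / (α * (α / 4) ^ 2) : ℝ≥0) : ℝ≥0∞) * ((α / 2 : ℝ≥0) : ℝ≥0∞) ^ 2 := by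
          gcongr
          exact (ennSum_ennComp_le h0 h1 hd (hm.trans hle)).trans (by gcongr)
      _ = ((1 + α / 4 / (α * (α / 4) ^ 2) * (α / 2) ^ 2 : ℝ≥0) : ℝ≥0∞) := by push_cast; rfl
      _ = ((2 : ℝ≥0) : ℝ≥0∞) := by congr 1; field_simp; norm_num
      _ ≤ 2 := by simp

theorem ennSlope_mono_coeff {f g : PowerSeries ℝ≥0∞} (h : ∀ n, coeff n f ≤ coeff n g)
    (z : ℝ≥0∞) : ennSlope f z ≤ ennSlope g z :=
  ENNReal.tsum_le_tsum fun _ => mul_le_mul' (h _) le_rfl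

theorem exists_ennSum_koenigs_eq_one (hα : α ≠ 0) (hα1 : α ≤ 1)
    (h0 : d 0 = 0) (h1 : d 1 = 0) (hd : ∑' k, d k ≤ 1) :
    ∃ r : ℝ≥0, r ≠ 0 ∧ ennSum (koenigs d α) r = 1 := by
  have h4 : α / 4 ≠ 0 := by positivity
  have hsmall := ennSum_koenigs_le d α (ennSum_koenigsIter_small hα hα1 h0 h1 hd)
  -- Finiteness at one nonzero point makes every coefficient finite, hence the partial sums below
  -- continuous.
  have hfin : ∀ n, coeff n (koenigs d α) ≠ ∞ := by
    intro n hn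
    have := (ENNReal.le_tsum (f := fun n => coeff n (koenigs d α) * ((α / 4 : ℝ≥0) : ℝ≥0∞) ^ n)
      n).trans hsmall
    rw [hn, ENNReal.top_mul (pow_ne_zero _ (by exact_mod_cast h4))] at this
    exact absurd this (by simp)
  set S : Set ℝ≥0 := {z | ennSum (koenigs d α) z ≤ 1} with hS
  have hclosed : IsClosed S := by
    have : S = ⋂ t : Finset ℕ, {z : ℝ≥0 | ∑ n ∈ t, coeff n (koenigs d α) * (z : ℝ≥0∞) ^ n ≤ 1} := by
      ext z
      simp [hS, ennSum, ENNReal.tsum_eq_iSup_sum]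
    rw [this]
    refine isClosed_iInter fun t => isClosed_le ?_ continuous_const
    refine continuous_finsetSum _ fun n _ => ?_
    exact (ENNReal.continuous_const_mul (hfin n)).comp
      ((ENNReal.continuous_pow n).comp ENNReal.continuous_coe)
  -- The linear term alone is `z`.
  have hbdd : BddAbove S := by
    refine ⟨1, fun z hz => ?_⟩
    have := (ENNReal.le_tsum (f := fun n => coeff n (koenigs d α) * (z : ℝ≥0∞) ^ n) 1).trans hz
    simpa [coeff_one_koenigs] using this
  have hmem : sSup S ∈ S := hclosed.csSup_mem ⟨_, hsmall⟩ hbdd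
  have hr0 : sSup S ≠ 0 := (lt_of_lt_of_le (pos_iff_ne_zero.2 h4) (le_csSup hbdd hsmall)).ne'
  refine ⟨sSup S, hr0, le_antisymm hmem ?_⟩
  set r := sSup S with hr
  by_contra! hlt
  lift ennSum (koenigs d α) r to ℝ≥0 using hlt.ne_top with p hp
  have hp1 : p < 1 := by exact_mod_cast hlt
  have hslope : (r : ℝ≥0∞) * ennSlope (koenigs d α) r = p := by
    rw [hp, ennSum_eq_mul_ennSlope (coeff_zero_koenigs d α)]
  have hslope' : ennSlope (koenigs d α) r = ((p / r : ℝ≥0) : ℝ≥0∞) := by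
    rw [ENNReal.coe_div hr0, ENNReal.eq_div_iff (by exact_mod_cast hr0) ENNReal.coe_ne_top, hslope]
  -- This expression will bound every iterate at `r + δ`. Its limit `p` is below `1`, so some `δ >
  -- 0` puts `r + δ` in `S`, against maximality of `r`.
  have hlim : Tendsto (fun δ : ℝ≥0 => (r + δ) * (p / r + δ / (α * (r + δ) ^ 2))) (𝓝[>] 0) (𝓝 p) := by
    have : ContinuousAt (fun δ : ℝ≥0 => (r + δ) * (p / r + δ / (α * (r + δ) ^ 2))) 0 := by
      have : α * (r + 0) ^ 2 ≠ 0 := by rw [add_zero]; positivity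
      fun_prop (disch := assumption)
    have h := this.tendsto.mono_left (nhdsWithin_le_nhds (s := Set.Ioi 0))
    convert! h using 2
    simp
    field_simp
  obtain ⟨δ, hδ1, hδ0⟩ := ((hlim.eventually (gt_mem_nhds hp1)).and self_mem_nhdsWithin).exists
  have hz : r + δ ≠ 0 := fun h => hr0 (by simpa using (add_eq_zero.1 h).1)
  have hin : r + δ ∈ S := by
    refine ennSum_koenigs_le d α fun m => ?_
    induction m with
    | zero => simp [koenigsIter_zero, ennSum]
    | succ m ih =>
      rw [ennSum_eq_mul_ennSlope (coeff_zero_koenigsIter d α _), koenigsIter_succ]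
      calc _ ≤ (↑(r + δ) : ℝ≥0∞) * (((p / r : ℝ≥0) : ℝ≥0∞)
            + ((δ / (α * (r + δ) ^ 2) : ℝ≥0) : ℝ≥0∞) * 1) := by
            gcongr
            refine (ennSlope_koenigsStep_le hα _ r δ hz).trans ?_
            gcongr
            · rw [← hslope', ← koenigsIter_succ]
              exact ennSlope_mono_coeff (coeff_koenigsIter_le d α _) _
            · exact (ennSum_ennComp_le h0 h1 hd ih).trans (pow_le_one' ih 2)
        _ = (((r + δ) * (p / r + δ / (α * (r + δ) ^ 2)) : ℝ≥0) : ℝ≥0∞) := by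
            rw [mul_one]; push_cast; rfl
        _ ≤ 1 := by exact_mod_cast hδ1.le
  have := le_csSup hbdd hin
  rw [← hr] at this
  exact absurd this (not_le.2 (lt_add_of_pos_right r hδ0))

theorem mul_coeff_succ_koenigs (hα : α ≠ 0) (h0 : d 0 = 0) (h1 : d 1 = 0) (n : ℕ) :
    ((α * n : ℝ≥0) : ℝ≥0∞) * coeff (n + 1) (koenigs d α)
      = coeff (n + 1) (ennComp d (koenigs d α)) := by
  cases n with
  | zero =>
    rw [Nat.cast_zero, mul_zero, ENNReal.coe_zero, zero_mul, zero_add, ennComp, coeff_mk, eq_comm,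
      ENNReal.tsum_eq_zero]
    intro k
    match k with
    | 0 => simp [h0]
    | 1 => simp [h1]
    | k + 2 =>
      have : coeff 1 (koenigs d α ^ (k + 2)) = 0 := by
        rw [pow_succ, pow_succ, coeff_mul, Finset.Nat.antidiagonal_succ]
        simp [coeff_mul, coeff_zero_koenigs]
      rw [this, mul_zero]
  | succ n =>
    nth_rewrite 1 [← koenigsStep_koenigs]
    rw [coeff_succ_koenigsStep, if_neg (by omega), zero_add, ← mul_assoc, ← ENNReal.coe_mul,
      mul_inv_cancel₀ (by positivity), ENNReal.coe_one, one_mul]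

/-- The equation `α z f'(z) = α f(z) + ∑ dₖ f(z)ᵏ`, summed from the coefficient recursion without
any convergence assumption. -/
theorem tsum_mul_koenigs (hα : α ≠ 0) (h0 : d 0 = 0) (h1 : d 1 = 0) (z : ℝ≥0∞) :
    ∑' n : ℕ, (α : ℝ≥0∞) * n * (coeff n (koenigs d α) * z ^ n)
      = α * ennSum (koenigs d α) z + ∑' k, d k * ennSum (koenigs d α) z ^ k := by
  rw [← ennSum_ennComp, tsum_eq_zero_add' ENNReal.summable]
  conv_rhs => rw [ennSum, ennSum, tsum_eq_zero_add' ENNReal.summable,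
    tsum_eq_zero_add' (f := fun n => coeff n (ennComp d (koenigs d α)) * z ^ n) ENNReal.summable]
  have hc : coeff 0 (ennComp d (koenigs d α)) = 0 := by
    rw [ennComp, coeff_mk, ENNReal.tsum_eq_zero]
    intro k
    cases k with
    | zero => simp [h0]
    | succ k => rw [pow_succ, coeff_mul]; simp [coeff_zero_koenigs]
  rw [hc, coeff_zero_koenigs]
  simp only [zero_mul, mul_zero, zero_add]
  rw [← ENNReal.tsum_mul_left, ← ENNReal.tsum_add]
  refine tsum_congr fun n => ?_
  rw [← mul_coeff_succ_koenigs hα h0 h1]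
  push_cast
  ring

end

end PowerSeries

/-! ### Passage to real weights -/

theorem exists_weights {α : ℝ} (hα0 : 0 < α) (hα1 : α ≤ 1) :
    ∃ p : ℕ → ℝ, (∀ n, 0 ≤ p n) ∧ HasSum p 1 ∧ ∀ z : ℝ, 0 ≤ z → z < 1 →
      HasSum (fun n : ℕ => α * n * (p n * z ^ n)) (1 - (1 - ∑' n, p n * z ^ n) ^ α) := by
  set d : ℕ → ℝ≥0∞ := fun k => ENNReal.ofReal (rpowTail α k) with hd
  have h0 : d 0 = 0 := by simp [hd, rpowTail]
  have h1 : d 1 = 0 := by simp [hd, rpowTail]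
  have hdsum : ∑' k, d k ≤ 1 := tsum_ofReal_rpowTail_le hα0 hα1
  lift α to ℝ≥0 using hα0.le
  have hα : α ≠ 0 := by rintro rfl; simp at hα0
  obtain ⟨r, -, hr⟩ := PowerSeries.exists_ennSum_koenigs_eq_one hα (by exact_mod_cast hα1)
    h0 h1 hdsum
  set a : ℕ → ℝ≥0∞ := fun n => PowerSeries.coeff n (PowerSeries.koenigs d α) * (r : ℝ≥0∞) ^ n
    with ha
  have ha1 : ∑' n, a n = 1 := hr
  have hafin : ∀ n, a n ≠ ∞ := ENNReal.ne_top_of_tsum_ne_top (by simp [ha1])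
  have ha0 : a 0 = 0 := by simp only [ha, PowerSeries.coeff_zero_koenigs, zero_mul]
  have hsum : HasSum (fun n => (a n).toReal) 1 := by
    have := ENNReal.hasSum_toReal (f := a) (by simp [ha1])
    rwa [← ENNReal.tsum_toReal_eq hafin, ha1, ENNReal.toReal_one] at this
  refine ⟨fun n => (a n).toReal, fun n => ENNReal.toReal_nonneg, hsum, fun z hz0 hz1 => ?_⟩
  lift z to ℝ≥0 using hz0
  have hz1' : (z : ℝ≥0∞) ≤ 1 := by exact_mod_cast hz1.le
  set e : ℝ≥0∞ := ∑' n, a n * (z : ℝ≥0∞) ^ n with he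
  -- As `a 0 = 0` and the `a n` sum to `1`, the value stays below `1`, where the binomial expansion
  -- is valid.
  have hez : e ≤ z := by
    calc e ≤ ∑' n, a n * (z : ℝ≥0∞) := by
          refine ENNReal.tsum_le_tsum fun n => ?_
          cases n with
          | zero => simp [ha0]
          | succ n => exact mul_le_mul' le_rfl (pow_le_of_le_one zero_le hz1' (by omega))
      _ = z := by rw [ENNReal.tsum_mul_right, ha1, one_mul]
  have hefin : e ≠ ∞ := (hez.trans_lt ENNReal.coe_lt_top).ne
  have hesum : e = PowerSeries.ennSum (PowerSeries.koenigs d α) (r * z) := by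
    rw [he, PowerSeries.ennSum]
    exact tsum_congr fun n => by rw [ha, mul_pow]; ring
  have hereal : ∑' n, (a n).toReal * (z : ℝ) ^ n = e.toReal := by
    rw [he, ENNReal.tsum_toReal_eq fun n =>
      ENNReal.mul_ne_top (hafin n) (ENNReal.pow_ne_top ENNReal.coe_ne_top)]
    simp
  have hez' : e.toReal ≤ z := by
    simpa using ENNReal.toReal_mono ENNReal.coe_ne_top hez
  have hmain := PowerSeries.tsum_mul_koenigs hα h0 h1 (r * z)
  rw [← hesum] at hmain
  have hdfin : ∑' k, d k * e ^ k ≠ ∞ := by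
    refine ((ENNReal.tsum_le_tsum fun k => ?_).trans hdsum).trans_lt ENNReal.one_lt_top |>.ne
    exact mul_le_of_le_one_right' (pow_le_one' (hez.trans hz1') k)
  have hfin : (α : ℝ≥0∞) * e + ∑' k, d k * e ^ k ≠ ∞ :=
    ENNReal.add_ne_top.2 ⟨ENNReal.mul_ne_top ENNReal.coe_ne_top hefin, hdfin⟩
  have hval : ((α : ℝ≥0∞) * e + ∑' k, d k * e ^ k).toReal = 1 - (1 - e.toReal) ^ (α : ℝ) := by
    rw [ENNReal.toReal_add (ENNReal.mul_ne_top ENNReal.coe_ne_top hefin) hdfin,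
      ENNReal.tsum_toReal_eq (ENNReal.ne_top_of_tsum_ne_top hdfin)]
    have hs := (hasSum_rpowTail (α := α) (s := e.toReal) ENNReal.toReal_nonneg
      (hez'.trans_lt hz1)).tsum_eq
    have : ∀ k, (d k * e ^ k).toReal = rpowTail α k * e.toReal ^ k := fun k => by
      rw [ENNReal.toReal_mul, ENNReal.toReal_pow,
        ENNReal.toReal_ofReal (rpowTail_nonneg hα0 hα1 k)]
    simp_rw [this, hs]
    simp
  rw [hereal]
  rw [← hval, ← hmain]
  have hL := hmain ▸ hfin
  rw [ENNReal.tsum_toReal_eq (ENNReal.ne_top_of_tsum_ne_top hL)]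
  convert! ENNReal.hasSum_toReal hL using 2 with n
  simp only [ha, mul_pow, ENNReal.toReal_mul, ENNReal.toReal_pow, ENNReal.coe_toReal,
    ENNReal.toReal_natCast]
  ring

/-! ### The initial value problem: uniqueness and the series solution -/

theorem IsProfileFunction.continuousOn {α : ℝ} {F : ℝ → ℝ} (hF : IsProfileFunction α F) :
    ContinuousOn F (Set.Ici 0) :=
  fun x hx => (hF.hasDeriv x hx).continuousWithinAt

/-- Zero is a strict barrier: wherever `F = 0`, the derivative is `1`. -/
theorem IsProfileFunction.nonneg {α : ℝ} (hα : 0 < α) {F : ℝ → ℝ} (hF : IsProfileFunction α F)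
    {x : ℝ} (hx : 0 ≤ x) : 0 ≤ F x := by
  have h := image_le_of_deriv_right_lt_deriv_boundary' (f := fun _ => (0 : ℝ)) (f' := fun _ => 0)
    (a := 0) (b := x) continuousOn_const (fun _ _ => hasDerivWithinAt_const _ _ _)
    (B := F) (B' := fun y => 1 - F y ^ α) hF.map_zero.ge
    (hF.continuousOn.mono Set.Icc_subset_Ici_self)
    (fun y hy => (hF.hasDeriv y hy.1).mono (Set.Ici_subset_Ici.2 hy.1))
    (fun y _ hy => by simp [← hy, Real.zero_rpow hα.ne'])
  exact h (Set.right_mem_Icc.2 hx)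

/-- Since `t ↦ t^α` is only Hölder at `0`, uniqueness comes from its monotonicity: `(F - G)²` is
nonincreasing and starts at `0`. -/
theorem IsProfileFunction.eqOn {α : ℝ} (hα : 0 < α) {F G : ℝ → ℝ} (hF : IsProfileFunction α F)
    (hG : IsProfileFunction α G) : Set.EqOn F G (Set.Ici 0) := by
  intro x hx
  have hderiv : ∀ y ∈ interior (Set.Ici (0 : ℝ)), HasDerivAt (fun y => (F y - G y) ^ 2)
      (2 * (F y - G y) * (G y ^ α - F y ^ α)) y := by
    intro y hy
    rw [interior_Ici] at hy
    have hn : Set.Ici (0 : ℝ) ∈ 𝓝 y := Ici_mem_nhds hy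
    have h := (((hF.hasDeriv y (le_of_lt hy)).hasDerivAt hn).sub
      ((hG.hasDeriv y (le_of_lt hy)).hasDerivAt hn)).pow 2
    convert! h using 1
    simp
  have hanti : AntitoneOn (fun y => (F y - G y) ^ 2) (Set.Ici 0) := by
    refine antitoneOn_of_deriv_nonpos (convex_Ici 0)
      ((hF.continuousOn.sub hG.continuousOn).pow 2)
      (fun y hy => (hderiv y hy).differentiableAt.differentiableWithinAt) fun y hy => ?_
    rw [(hderiv y hy).deriv]
    have hy0 : 0 ≤ y := interior_subset hy
    have hFy := hF.nonneg hα hy0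
    have hGy := hG.nonneg hα hy0
    rcases le_total (F y) (G y) with h | h
    · have := Real.rpow_le_rpow hFy h hα.le
      exact mul_nonpos_of_nonpos_of_nonneg (by linarith) (by linarith)
    · have := Real.rpow_le_rpow hGy h hα.le
      exact mul_nonpos_of_nonneg_of_nonpos (by linarith) (by linarith)
  have h := hanti Set.self_mem_Ici hx hx
  simp only [hF.map_zero, hG.map_zero, sub_self] at h
  have h2 : (F x - G x) ^ 2 = 0 := le_antisymm (by simpa using h) (sq_nonneg _)
  exact sub_eq_zero.1 (pow_eq_zero_iff two_ne_zero |>.1 h2)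

theorem isProfileFunction_one_sub_tsum {α : ℝ} (hα : 0 < α) {p : ℕ → ℝ} (hp : ∀ n, 0 ≤ p n)
    (hsum : HasSum p 1)
    (hode : ∀ z : ℝ, 0 ≤ z → z < 1 →
      HasSum (fun n : ℕ => α * n * (p n * z ^ n)) (1 - (1 - ∑' n, p n * z ^ n) ^ α)) :
    IsProfileFunction α fun x => 1 - ∑' n : ℕ, p n * Real.exp (-(x * (α * n))) := by
  have hexp : ∀ (x : ℝ) (n : ℕ), Real.exp (-(x * (α * n))) = Real.exp (-(α * x)) ^ n := by
    intro x n
    rw [← Real.exp_nat_mul]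
    congr 1
    ring
  have hbound : ∀ (n : ℕ) (x : ℝ), 0 ≤ x → ‖p n * Real.exp (-(x * (α * n)))‖ ≤ p n := by
    intro n x hx
    rw [Real.norm_of_nonneg (mul_nonneg (hp n) (Real.exp_pos _).le)]
    exact mul_le_of_le_one_right (hp n) (Real.exp_le_one_iff.2 (by
      have : 0 ≤ x * (α * n) := by positivity
      linarith))
  set F : ℝ → ℝ := fun x => 1 - ∑' n : ℕ, p n * Real.exp (-(x * (α * n))) with hF
  have hF0 : F 0 = 0 := by simp [hF, hsum.tsum_eq]
  have hcont : ContinuousOn F (Set.Ici 0) :=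
    continuousOn_const.sub (continuousOn_tsum (fun n => by fun_prop) hsum.summable hbound)
  have hlt : ∀ x : ℝ, 0 < x → Real.exp (-(α * x)) < 1 := fun x hx =>
    Real.exp_lt_one_iff.2 (by have := mul_pos hα hx; linarith)
  have hderiv : ∀ x : ℝ, 0 < x → HasDerivAt F (1 - F x ^ α) x := by
    intro x hx
    -- On `(x/2, ∞)` the differentiated series is dominated by its values at `x/2`.
    have hx2 : 0 < x / 2 := by linarith
    have hs := (hode _ (Real.exp_pos (-(α * (x / 2)))).le (hlt _ hx2)).summable
    have hd := hasDerivAt_tsum_of_isPreconnected (𝕜 := ℝ)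
      (g := fun (n : ℕ) x => p n * Real.exp (-(x * (α * n))))
      (g' := fun (n : ℕ) x => -(α * n * (p n * Real.exp (-(α * x)) ^ n)))
      (t := Set.Ioi (x / 2)) (y₀ := x) (y := x) hs isOpen_Ioi isPreconnected_Ioi
      (fun n y _ => by
        have h := (((hasDerivAt_id y).mul_const (α * (n : ℝ))).neg.exp).const_mul (p n)
        convert! h using 1
        simp only [id, Pi.neg_apply, hexp]
        ring)
      (fun n y hy => by
        have hy : x / 2 < y := hy
        have : 0 ≤ α * n * (p n * Real.exp (-(α * y)) ^ n) :=
          mul_nonneg (by positivity) (mul_nonneg (hp n) (by positivity))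
        rw [norm_neg, Real.norm_of_nonneg this]
        have := hp n
        gcongr)
      (by simp; linarith)
      (hsum.summable.of_norm_bounded fun n => hbound n x hx.le) (by simp; linarith)
    have h := hd.const_sub 1
    convert! h using 1
    rw [tsum_neg, (hode _ (Real.exp_pos _).le (hlt x hx)).tsum_eq, neg_neg]
    simp only [hF, hexp]
  refine ⟨hF0, fun x hx => ?_⟩
  rcases hx.eq_or_lt with rfl | hx
  -- The differentiated series is not controlled at `0`; the right derivative there is the limit of
  -- `1 - F^α`.
  · refine hasDerivWithinAt_Ici_of_tendsto_deriv (s := Set.Ioi 0)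
      (fun y hy => (hderiv y hy).differentiableAt.differentiableWithinAt)
      ((hcont 0 Set.self_mem_Ici).mono Set.Ioi_subset_Ici_self) self_mem_nhdsWithin ?_
    have h : Tendsto (fun y => 1 - F y ^ α) (𝓝[>] 0) (𝓝 (1 - F 0 ^ α)) :=
      (((hcont 0 Set.self_mem_Ici).mono Set.Ioi_subset_Ici_self).tendsto.rpow_const
        (Or.inr hα.le)).const_sub 1
    refine h.congr' ?_
    filter_upwards [self_mem_nhdsWithin] with y hy using ((hderiv y hy).deriv).symm
  · exact (hderiv x hx).hasDerivWithinAt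

/-! ### Laplace transform of an atomic measure, and conclusion -/

theorem exists_isProbabilityMeasure_laplace_eq_tsum {p : ℕ → ℝ} (hp : ∀ n, 0 ≤ p n)
    (hsum : HasSum p 1) (t : ℕ → ℝ≥0) :
    ∃ σ : Measure ℝ≥0, IsProbabilityMeasure σ ∧ ∀ x : ℝ, 0 ≤ x →
      ∫ s : ℝ≥0, Real.exp (-(x * (s : ℝ))) ∂σ = ∑' n, p n * Real.exp (-(x * (t n : ℝ))) := by
  set σ : Measure ℝ≥0 := Measure.sum fun n => ENNReal.ofReal (p n) • Measure.dirac (t n) with hσ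
  have hprob : IsProbabilityMeasure σ := by
    refine ⟨?_⟩
    rw [hσ, Measure.sum_apply _ MeasurableSet.univ]
    simp only [Measure.smul_apply, measure_univ, smul_eq_mul, mul_one]
    rw [← ENNReal.ofReal_tsum_of_nonneg hp hsum.summable, hsum.tsum_eq, ENNReal.ofReal_one]
  refine ⟨σ, hprob, fun x hx => ?_⟩
  have hint : Integrable (fun s : ℝ≥0 => Real.exp (-(x * (s : ℝ)))) σ := by
    refine Integrable.of_bound (by fun_prop) 1 (Eventually.of_forall fun s => ?_)
    rw [Real.norm_of_nonneg (Real.exp_pos _).le]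
    refine Real.exp_le_one_iff.2 ?_
    have : 0 ≤ x * (s : ℝ) := by positivity
    linarith
  rw [hσ, integral_sum_measure hint]
  refine tsum_congr fun n => ?_
  rw [integral_smul_measure, integral_dirac, ENNReal.toReal_ofReal (hp n), smul_eq_mul]

theorem corollary4p2 (α : ℝ) (hα0 : 0 < α) (hα1 : α ≤ 1) :
    (∃ F : ℝ → ℝ, IsProfileFunction α F) ∧
    ∃ σ : Measure ℝ≥0, IsProbabilityMeasure σ ∧
      ∀ F : ℝ → ℝ, IsProfileFunction α F →
        ∀ x : ℝ, 0 ≤ x → 1 - F x = ∫ t : ℝ≥0, Real.exp (-(x * (t : ℝ))) ∂σ := by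
  obtain ⟨p, hp, hsum, hz⟩ := exists_weights hα0 hα1
  have hsol := isProfileFunction_one_sub_tsum hα0 hp hsum hz
  obtain ⟨σ, hσ, hlap⟩ := exists_isProbabilityMeasure_laplace_eq_tsum hp hsum
    fun n => Real.toNNReal (α * n)
  refine ⟨⟨_, hsol⟩, σ, hσ, fun F hF x hx => ?_⟩
  rw [hlap x hx, hF.eqOn hα0 hsol hx]
  simp only [_root_.sub_sub_cancel]
  exact tsum_congr fun n => by rw [Real.coe_toNNReal _ (by positivity)]
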